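/- Let $V$ be a Euclidean Jordan algebra of rank $n$, that is, a finite-dimensional real inner product space with a bilinear commutative product $\circ$ that has a unit element $e$ and satisfies $(x\circ y)\circ x^2=x\circ(y\circ x^2)$ and $\langle x\circ y,z\rangle=\langle x,y\circ z\rangle$ for all $x,y,z\in V$; the rank is the largest degree of the minimal polynomial of an element of $V$. By the spectral theorem every $x\in V$ can be written as $x=\lambda_1(x)e_1+\cdots+\lambda_n(x)e_n$, where $\{e_1,\dots,e_n\}$ is a Jordan frame (mutually orthogonal primitive idempotents with sum $e$) and the eigenvalues $\lambda_1(x)\ge\cdots\ge\lambda_n(x)$ depend only on $x$; write $\lambda(x)=(\lambda_1(x),\dots,\lambda_n(x))$ and $\operatorname{tr}(x)=\sum_i\lambda_i(x)$. Assume that the inner product of $V$ is the trace inner product, $\langle x,y\rangle=\operatorname{tr}(x\circ y)$. For $p,q\in\mathbb{R}^n$ let $p*q$ be the componentwise product and $p^\downarrow$ the decreasing rearrangement of $p$; write $p\prec q$ if $\sum_{i=1}^k p_i^\downarrow\le\sum_{i=1}^k q_i^\downarrow$ for all $1\le k\le n$ and $\sum_{i=1}^n p_i^\downarrow=\sum_{i=1}^n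 q_i^\downarrow$. A linear map $D:V\to V$ is doubly stochastic if it maps $V_+=\{x\in V:\lambda_i(x)\ge 0 \text{ for all } i\}$ into itself and satisfies $D(e)=e$ and $D^*(e)=e$, where $D^*$ is the adjoint of $D$. Let $T:V\to V$ be a linear map. Then the following are equivalent: (i) There exists a vector $q\in\mathbb{R}^n$ with $q_1\ge q_2\ge\cdots\ge q_n$ such that $\lambda(T(x))\prec q*\lambda(x)$ for all $x\in V$. (ii) $T$ is a scalar multiple of a doubly stochastic map, that is, $T=tD$ for some $t\in\mathbb{R}$ and some doubly stochastic linear map $D:V\to V$. -/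

import Mathlib

open scoped InnerProductSpace

/-- A Euclidean Jordan algebra structure on a real inner product space `V` (finite dimensionality
is a separate assumption): a bilinear commutative product with unit `1` which satisfies the Jordan
identity `(x ∘ y) ∘ x² = x ∘ (y ∘ x²)` (the class `IsCommJordan`) and for which the inner product
is associative. -/
class EuclideanJordanAlgebra (V : Type*) [NormedAddCommGroup V] [InnerProductSpace ℝ V]
    extends CommMagma V, One V, IsCommJordan V where
  one_mul' : ∀ x : V, 1 * x = x
  add_mul' : ∀ x y z : V, (x + y) * z = x * z + y * z
  smul_mul' : ∀ (t : ℝ) (x y : V), (t • x) * y = t • (x * y)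
  inner_mul' : ∀ x y z : V, ⟪x * y, z⟫_ℝ = ⟪x, y * z⟫_ℝ

namespace EuclideanJordanAlgebra

section Algebra

variable {V : Type*} [NormedAddCommGroup V] [InnerProductSpace ℝ V] [EuclideanJordanAlgebra V]

/-- Powers in a Jordan algebra: `x⁰ = 1` and `xᵏ⁺¹ = x ∘ xᵏ`. -/
def jpow (x : V) : ℕ → V
  | 0 => 1
  | k + 1 => x * jpow x k

variable (V) in
/-- The rank: the largest degree of the minimal polynomial of an element `x`, that is, the largest
dimension of the span of the powers of an element. (The set is bounded by `dim V`.) -/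
noncomputable def rank : ℕ :=
  sSup (Set.range fun x : V => Module.finrank ℝ (Submodule.span ℝ (Set.range (jpow x))))

/-- `c² = c`. -/
def IsIdempotent (c : V) : Prop := c * c = c

/-- A nonzero idempotent that is not the sum of two nonzero idempotents. -/
def IsPrimitive (c : V) : Prop :=
  IsIdempotent c ∧ c ≠ 0 ∧
    ∀ a b : V, IsIdempotent a → IsIdempotent b → a ≠ 0 → b ≠ 0 → c ≠ a + b

/-- A Jordan frame: mutually orthogonal primitive idempotents that add up to the unit. -/
def IsJordanFrame (e : Fin (rank V) → V) : Prop :=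
  (∀ i, IsPrimitive (e i)) ∧ (∀ i j, i ≠ j → e i * e j = 0) ∧ ∑ i, e i = 1

/-- `v` lists the eigenvalues of `x` in decreasing order: there is a Jordan frame `e` with
`x = v₁ e₁ + ⋯ + vₙ eₙ`. -/
def IsEigenvalueVector (x : V) (v : Fin (rank V) → ℝ) : Prop :=
  Antitone v ∧ ∃ e : Fin (rank V) → V, IsJordanFrame e ∧ x = ∑ i, v i • e i

open Classical in
/-- The eigenvalue vector `λ(x)`, with decreasing components. In a finite-dimensional algebra it
exists and is unique, by the spectral theorem, so that the default value is never taken. -/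
noncomputable def eigenvalues (x : V) : Fin (rank V) → ℝ :=
  if h : ∃ v, IsEigenvalueVector x v then h.choose else 0

/-- The trace: the sum of the eigenvalues. -/
noncomputable def trace (x : V) : ℝ := ∑ i, eigenvalues x i

variable (V) in
/-- The symmetric cone: the elements all of whose eigenvalues are nonnegative. -/
def symmetricCone : Set V := {x | ∀ i, 0 ≤ eigenvalues x i}

/-- Doubly stochastic: `T(V₊) ⊆ V₊`, `T(e) = e` and `T*(e) = e`. -/
def IsDoublyStochastic [FiniteDimensional ℝ V] (T : V →ₗ[ℝ] V) : Prop :=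
  (∀ x ∈ symmetricCone V, T x ∈ symmetricCone V) ∧ T 1 = 1 ∧ LinearMap.adjoint T 1 = 1

end Algebra

/-- The decreasing rearrangement `p↓` of a vector. -/
noncomputable def decr {n : ℕ} (p : Fin n → ℝ) : Fin n → ℝ := fun i => p (Tuple.sort (fun j => -p j) i)

/-- `S_k(p)`: the sum of the `k` largest components of `p` (of all of them if `k ≥ n`). -/
noncomputable def sumLargest {n : ℕ} (k : ℕ) (p : Fin n → ℝ) : ℝ :=
  ∑ i with i.val < k, decr p i

/-- Weak majorization of vectors. -/
def WeaklyMajorized {n : ℕ} (p q : Fin n → ℝ) : Prop :=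
  ∀ k : ℕ, 1 ≤ k → k ≤ n → sumLargest k p ≤ sumLargest k q

/-- Majorization of vectors, `p ≺ q`. -/
def Majorized {n : ℕ} (p q : Fin n → ℝ) : Prop :=
  WeaklyMajorized p q ∧ ∑ i, decr p i = ∑ i, decr q i

end EuclideanJordanAlgebra

/-! From (i) to (ii): a primitive idempotent `c` has eigenvalues `(1, 0, …, 0)` and `-c` has `(0, …,
0, -1)`. The equality of total sums in the majorization gives `tr T(c) = q₁` and `tr T(-c) = -qₙ`.
The trace is linear, being `⟪·, 1⟫`, so `q₁ = qₙ` and the decreasing vector `q` is a constant `t`.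
Majorization keeps all components between the extremes of the majorizing vector. Hence `T 1 = t •
1`, `T` multiplies traces by `t`, and `T` sends the cone into `t` times the cone. So `t⁻¹ • T` is
doubly stochastic when `t ≠ 0`, while `T = 0` when `t = 0`.

From (ii) to (i): if `e` and `f` are Jordan frames diagonalizing `x` and `t • D x`, the matrix `⟪D
eⱼ, fᵢ⟫` is doubly stochastic and maps `t λ(x)` to `λ(t • D x)`. This gives the majorization with
constant `q = t`.

Both directions rest on the spectral theorem with exactly `rank V` idempotents
(`exists_isOrthogonalSystem_rank`). Diagonalizing multiplication by `x` on the span of the powers of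
`x` may give fewer idempotents, but it gives enough for a dense set of `x`, and compactness passes
to the limit. Uniqueness of eigenvalues is never proved: what is needed about the chosen vector is
read off a frame realizing it. -/

namespace EuclideanJordanAlgebra

/-! ### Multiplication operators: idempotents and powers. -/

section Basic

variable {V : Type*} [NormedAddCommGroup V] [InnerProductSpace ℝ V] [EuclideanJordanAlgebra V]

/-- The (nonassociative, commutative) ring underlying a Euclidean Jordan algebra. -/
@[reducible]
def toNonUnitalNonAssocCommRing : NonUnitalNonAssocCommRing V :=
  { (inferInstance : AddCommGroup V), (inferInstance : CommMagma V) with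
    left_distrib := fun a b c => by
      rw [mul_comm a, add_mul', mul_comm b, mul_comm c]
    right_distrib := add_mul'
    zero_mul := fun a => by
      have h := smul_mul' (0 : ℝ) (0 : V) a
      rwa [zero_smul, zero_smul] at h
    mul_zero := fun a => by
      have h := smul_mul' (0 : ℝ) (0 : V) a
      rw [mul_comm]
      rwa [zero_smul, zero_smul] at h }

attribute [local instance] toNonUnitalNonAssocCommRing

theorem isScalarTower : IsScalarTower ℝ V V := ⟨fun t x y => smul_mul' t x y⟩

theorem smulCommClass : SMulCommClass ℝ V V :=
  ⟨fun t x y => by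
    simp only [smul_eq_mul]
    rw [mul_comm x (t • y), smul_mul', mul_comm y]⟩

attribute [local instance] isScalarTower smulCommClass

theorem mul_one' (x : V) : x * 1 = x := by rw [mul_comm, one_mul']

theorem inner_mul_left (x y z : V) : ⟪x * y, z⟫_ℝ = ⟪y, x * z⟫_ℝ := by
  rw [mul_comm, inner_mul']

theorem inner_one_right_mul (x y : V) : ⟪x * y, 1⟫_ℝ = ⟪x, y⟫_ℝ := by
  rw [inner_mul', mul_one']

theorem inner_one_of_isIdempotent {c : V} (hc : IsIdempotent c) : ⟪c, 1⟫_ℝ = ⟪c, c⟫_ℝ := by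
  conv_lhs => rw [← hc]
  exact inner_one_right_mul c c

/-- The full linearization of the Jordan identity. -/
theorem linearized_jordan (a b c z : V) :
    a * ((b * c) * z) - (b * c) * (a * z) + (b * ((c * a) * z) - (c * a) * (b * z))
      + (c * ((a * b) * z) - (a * b) * (c * z)) = 0 := by
  have h := two_nsmul_lie_lmul_lmul_add_add_eq_zero a b c
  have h2 := congrArg (fun f : AddMonoid.End V => f z) h
  simp only [Ring.lie_def] at h2
  have h3 : (2 : ℕ) • (a * ((b * c) * z) - (b * c) * (a * z) + (b * ((c * a) * z) - (c * a) * (b * z))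
      + (c * ((a * b) * z) - (a * b) * (c * z))) = 0 := h2
  rw [← Nat.cast_smul_eq_nsmul ℝ] at h3
  exact (smul_eq_zero.mp h3).resolve_left (by norm_num)

/-- Multiplication by an idempotent satisfies `2L³ - 3L² + L = 0`. -/
theorem mul_cubic_of_isIdempotent {c : V} (hc : IsIdempotent c) (y : V) :
    (2 : ℝ) • (c * (c * (c * y))) = (3 : ℝ) • (c * (c * y)) - c * y := by
  have h := linearized_jordan y c c c
  have hc' : c * c = c := hc
  simp only [hc'] at h
  rw [mul_comm y c, mul_comm (c * y) c] at h
  rw [← sub_eq_zero, ← h]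
  module

/-- By the cubic relation, `L`, multiplication by `c`, has spectrum in `{0, 1/2, 1}`. There `2L² -
L` is the projection onto the 1-space and `4(L - L²)` the one onto the 1/2-space, so `L = (2L² - L)²
+ 8(L - L²)²`, a sum of squares of symmetric operators. -/
theorem inner_mul_self_of_isIdempotent {c : V} (hc : IsIdempotent c) (y : V) :
    ⟪c * y, y⟫_ℝ = ‖(2 : ℝ) • (c * (c * y)) - c * y‖ ^ 2
      + 8 * ‖c * y - c * (c * y)‖ ^ 2 := by
  have h1 := mul_cubic_of_isIdempotent hc y
  have e1 := congrArg (fun w => ⟪w, y⟫_ℝ) h1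
  have e2 := congrArg (fun w => ⟪w, c * y⟫_ℝ) h1
  simp only [inner_sub_left, inner_smul_left, RCLike.conj_to_real] at e1 e2
  have s1 : ⟪c * (c * (c * y)), y⟫_ℝ = ⟪c * (c * y), c * y⟫_ℝ := inner_mul_left _ _ _
  have s2 : ⟪c * (c * y), y⟫_ℝ = ⟪c * y, c * y⟫_ℝ := inner_mul_left _ _ _
  have s3 : ⟪c * (c * (c * y)), c * y⟫_ℝ = ⟪c * (c * y), c * (c * y)⟫_ℝ := inner_mul_left _ _ _
  rw [s1, s2] at e1
  rw [s3] at e2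
  rw [← real_inner_self_eq_norm_sq, ← real_inner_self_eq_norm_sq]
  simp only [inner_sub_left, inner_sub_right, inner_smul_left, inner_smul_right,
    RCLike.conj_to_real]
  rw [real_inner_comm (c * (c * y)) (c * y)]
  linarith

theorem inner_mul_self_nonneg_of_isIdempotent {c : V} (hc : IsIdempotent c) (y : V) :
    0 ≤ ⟪c * y, y⟫_ℝ := by
  rw [inner_mul_self_of_isIdempotent hc]
  positivity

theorem inner_nonneg_of_isIdempotent {c d : V} (hc : IsIdempotent c) (hd : IsIdempotent d) :
    0 ≤ ⟪c, d⟫_ℝ := by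
  have h := inner_mul_self_nonneg_of_isIdempotent hc d
  rwa [inner_mul', show d * d = d from hd] at h

theorem mul_eq_zero_of_isIdempotent {c d : V} (hc : IsIdempotent c) (hd : IsIdempotent d)
    (h : ⟪c, d⟫_ℝ = 0) : c * d = 0 := by
  have h1 := inner_mul_self_of_isIdempotent hc d
  rw [inner_mul', show d * d = d from hd, h] at h1
  have h2 : ‖(2 : ℝ) • (c * (c * d)) - c * d‖ ^ 2 = 0 := by
    nlinarith [sq_nonneg ‖(2 : ℝ) • (c * (c * d)) - c * d‖, sq_nonneg ‖c * d - c * (c * d)‖]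
  have h3 : ‖c * d - c * (c * d)‖ ^ 2 = 0 := by
    nlinarith [sq_nonneg ‖(2 : ℝ) • (c * (c * d)) - c * d‖, sq_nonneg ‖c * d - c * (c * d)‖]
  have h4 : (2 : ℝ) • (c * (c * d)) - c * d = 0 := by simpa using h2
  have h5 : c * d - c * (c * d) = 0 := by simpa using h3
  -- Both Peirce components on which multiplication by `c` is nonzero vanish.
  have h6 : c * d = ((2 : ℝ) • (c * (c * d)) - c * d) + (2 : ℝ) • (c * d - c * (c * d)) := by
    module
  rw [h6, h4, h5]; simp

/-- If the sum of two idempotents is an idempotent, then they are orthogonal. -/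
theorem mul_eq_zero_of_isIdempotent_add {a b : V} (ha : IsIdempotent a) (hb : IsIdempotent b)
    (hab : IsIdempotent (a + b)) : a * b = 0 := by
  have h : (a + b) * (a + b) = a + b := hab
  rw [mul_add, add_mul, add_mul, show a * a = a from ha, show b * b = b from hb, mul_comm b a] at h
  have h2 : (2 : ℝ) • (a * b) = (a + a * b + (a * b + b)) - (a + b) := by module
  rw [h, sub_self] at h2
  exact (smul_eq_zero.mp h2).resolve_left (by norm_num)

/-- Multiplication by `x`, as a linear map. -/
noncomputable def mulLeft (x : V) : V →ₗ[ℝ] V := LinearMap.mul ℝ V x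

@[simp] theorem mulLeft_apply (x y : V) : mulLeft x y = x * y := rfl

theorem mulLeft_isSymmetric (x : V) : (mulLeft x).IsSymmetric := fun y z => by
  simp only [mulLeft_apply, inner_mul_left]

/-- The linearized Jordan identity read as an operator identity. With `y = xᵏ` it is a two-step
recursion for multiplication by powers of `x`. -/
theorem mulLeft_mul_mul (x y : V) :
    mulLeft (x * (x * y)) = (2 : ℝ) • (mulLeft (x * y) * mulLeft x)
      - mulLeft x * mulLeft x * mulLeft y - mulLeft y * mulLeft x * mulLeft x
      + mulLeft (x * x) * mulLeft y := by
  ext a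
  have h := linearized_jordan a x y x
  simp only [LinearMap.sub_apply, LinearMap.add_apply, LinearMap.smul_apply, Module.End.mul_apply,
    mulLeft_apply]
  rw [mul_comm (x * y) x, mul_comm a (x * (x * y)), mul_comm a x, mul_comm (y * a) x,
    mul_comm (x * a) x, mul_comm (y * a) (x * x), mul_comm (x * a) (y * x), mul_comm y x] at h
  rw [← sub_eq_zero, ← h]
  module

theorem commute_mulLeft_jpow (x : V) (k : ℕ) :
    Commute (mulLeft x) (mulLeft (jpow x k)) := by
  have hxx : Commute (mulLeft x) (mulLeft (x * x)) := by
    ext a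
    simp only [Module.End.mul_apply, mulLeft_apply]
    have h := IsCommJordan.lmul_comm_rmul_rmul x a
    rw [mul_comm (x * x) (x * a), h, mul_comm a]
  have h01 : Commute (mulLeft x) (mulLeft (jpow x k)) ∧
      Commute (mulLeft x) (mulLeft (jpow x (k + 1))) := by
    induction k with
    | zero =>
      refine ⟨?_, ?_⟩
      · ext a
        simp [jpow, one_mul']
      · rw [show jpow x (0 + 1) = x from mul_one' x]
    | succ k ih =>
      refine ⟨ih.2, ?_⟩
      rw [show jpow x (k + 1 + 1) = x * (x * jpow x k) from rfl, mulLeft_mul_mul]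
      have h1 : Commute (mulLeft x) (mulLeft (x * jpow x k)) := ih.2
      have h0 := ih.1
      have hx := Commute.refl (mulLeft x)
      exact ((((h1.mul_right hx).smul_right _).sub_right ((hx.mul_right hx).mul_right h0)).sub_right
        ((h0.mul_right hx).mul_right hx)).add_right (hxx.mul_right h0)
  exact h01.1

end Basic

/-! ### Complete orthogonal systems of idempotents and the rank. -/

section OrthogonalSystem

variable {V : Type*} [NormedAddCommGroup V] [InnerProductSpace ℝ V] [EuclideanJordanAlgebra V]

attribute [local instance] toNonUnitalNonAssocCommRing isScalarTower smulCommClass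

theorem IsIdempotent.norm_le {c : V} (hc : IsIdempotent c) : ‖c‖ ≤ ‖(1 : V)‖ := by
  have h := real_inner_le_norm c 1
  rw [inner_one_of_isIdempotent hc, real_inner_self_eq_norm_sq] at h
  by_contra! hlt
  nlinarith [norm_nonneg (1 : V), norm_nonneg c]

/-- A complete system of orthogonal nonzero (not necessarily primitive) idempotents. -/
structure IsOrthogonalSystem {ι : Type*} [Fintype ι] (c : ι → V) : Prop where
  isIdempotent : ∀ i, IsIdempotent (c i)
  ne_zero : ∀ i, c i ≠ 0
  mul_eq_zero : ∀ i j, i ≠ j → c i * c j = 0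
  sum_eq_one : ∑ i, c i = 1

theorem IsJordanFrame.isOrthogonalSystem {e : Fin (rank V) → V} (he : IsJordanFrame e) :
    IsOrthogonalSystem e :=
  ⟨fun i => (he.1 i).1, fun i => (he.1 i).2.1, he.2.1, he.2.2⟩

namespace IsOrthogonalSystem

variable {ι : Type*} [Fintype ι] {c : ι → V}

theorem inner_eq_zero (hc : IsOrthogonalSystem c) {i j : ι} (hij : i ≠ j) : ⟪c i, c j⟫_ℝ = 0 := by
  rw [← inner_one_right_mul, hc.mul_eq_zero i j hij, inner_zero_left]

theorem inner_self_ne_zero (hc : IsOrthogonalSystem c) (i : ι) : ⟪c i, c i⟫_ℝ ≠ 0 :=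
  _root_.inner_self_ne_zero.mpr (hc.ne_zero i)

theorem linearIndependent (hc : IsOrthogonalSystem c) : LinearIndependent ℝ c :=
  linearIndependent_of_ne_zero_of_inner_eq_zero hc.ne_zero fun _ _ hij => hc.inner_eq_zero hij

theorem inner_sum_smul (hc : IsOrthogonalSystem c) (v : ι → ℝ) (i : ι) :
    ⟪∑ j, v j • c j, c i⟫_ℝ = v i * ⟪c i, c i⟫_ℝ := by
  rw [sum_inner, Finset.sum_eq_single i]
  · rw [inner_smul_left]; rfl
  · intro j _ hj
    rw [inner_smul_left, hc.inner_eq_zero hj, mul_zero]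
  · simp

theorem mul_sum_smul (hc : IsOrthogonalSystem c) (v : ι → ℝ) (i : ι) :
    c i * (∑ j, v j • c j) = v i • c i := by
  rw [Finset.mul_sum, Finset.sum_eq_single i]
  · rw [mul_smul_comm, show c i * c i = c i from hc.isIdempotent i]
  · intro j _ hj
    rw [mul_smul_comm, hc.mul_eq_zero i j hj.symm, smul_zero]
  · simp

theorem sum_smul_mul_sum_smul (hc : IsOrthogonalSystem c) (v w : ι → ℝ) :
    (∑ i, v i • c i) * (∑ i, w i • c i) = ∑ i, (v i * w i) • c i := by
  rw [Finset.sum_mul]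
  refine Finset.sum_congr rfl fun i _ => ?_
  rw [smul_mul_assoc, hc.mul_sum_smul, smul_smul]

theorem jpow_sum_smul (hc : IsOrthogonalSystem c) (v : ι → ℝ) (k : ℕ) :
    jpow (∑ i, v i • c i) k = ∑ i, v i ^ k • c i := by
  induction k with
  | zero => simp [jpow, hc.sum_eq_one]
  | succ k ih =>
    rw [jpow, ih, hc.sum_smul_mul_sum_smul]
    simp only [pow_succ']

/-- A polynomial acts on `∑ vⱼ cⱼ` through the coefficients, so the Lagrange polynomial equal to 1
at `vᵢ` and 0 at the other nodes produces `cᵢ`. -/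
theorem mem_span_range_jpow (hc : IsOrthogonalSystem c) {v : ι → ℝ} (hv : Function.Injective v)
    (i : ι) : c i ∈ Submodule.span ℝ (Set.range (jpow (∑ j, v j • c j))) := by
  classical
  let p : Polynomial ℝ := Lagrange.basis Finset.univ v i
  have h : ∑ k ∈ Finset.range (p.natDegree + 1), p.coeff k • jpow (∑ j, v j • c j) k = c i := by
    simp only [hc.jpow_sum_smul, Finset.smul_sum, smul_smul]
    rw [Finset.sum_comm]
    simp only [← Finset.sum_smul, ← Polynomial.eval_eq_sum_range]
    rw [Finset.sum_eq_single i]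
    · rw [Lagrange.eval_basis_self hv.injOn (Finset.mem_univ i), one_smul]
    · intro j _ hj
      rw [Lagrange.eval_basis_of_ne hj.symm (Finset.mem_univ j), zero_smul]
    · simp
  rw [← h]
  exact Submodule.sum_mem _ fun k _ =>
    Submodule.smul_mem _ _ (Submodule.subset_span (Set.mem_range_self k))

variable [FiniteDimensional ℝ V]

variable (V) in
theorem bddAbove_finrank_span_jpow :
    BddAbove (Set.range fun x : V =>
      Module.finrank ℝ (Submodule.span ℝ (Set.range (jpow x)))) :=
  ⟨Module.finrank ℝ V, by
    rintro _ ⟨x, rfl⟩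
    exact Submodule.finrank_le _⟩

theorem card_le_rank (hc : IsOrthogonalSystem c) : Fintype.card ι ≤ rank V := by
  let v : ι → ℝ := fun i => ((Fintype.equivFin ι i : ℕ) : ℝ)
  have hv : Function.Injective v := fun i j h => by
    have h' : (Fintype.equivFin ι i : ℕ) = Fintype.equivFin ι j := Nat.cast_injective h
    exact (Fintype.equivFin ι).injective (Fin.ext h')
  have h1 : Fintype.card ι ≤
      Module.finrank ℝ (Submodule.span ℝ (Set.range (jpow (∑ j, v j • c j)))) := by
    rw [← finrank_span_eq_card hc.linearIndependent]
    refine Submodule.finrank_mono (Submodule.span_le.mpr ?_)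
    rintro _ ⟨i, rfl⟩
    exact hc.mem_span_range_jpow hv i
  exact h1.trans (le_csSup (bddAbove_finrank_span_jpow V) ⟨_, rfl⟩)

/-- A complete orthogonal system of maximal size consists of primitive idempotents. -/
theorem isJordanFrame {e : Fin (rank V) → V} (he : IsOrthogonalSystem e) : IsJordanFrame e := by
  refine ⟨fun i => ⟨he.isIdempotent i, he.ne_zero i, ?_⟩, he.mul_eq_zero, he.sum_eq_one⟩
  intro a b ha hb ha0 hb0 hab
  have hab0 : a * b = 0 :=
    mul_eq_zero_of_isIdempotent_add ha hb (hab ▸ he.isIdempotent i)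
  -- The two inner products with `e j` are nonnegative and add up to zero.
  have horth : ∀ j, j ≠ i → a * e j = 0 ∧ b * e j = 0 := by
    intro j hj
    have h0 : ⟪a, e j⟫_ℝ + ⟪b, e j⟫_ℝ = 0 := by
      rw [← inner_add_left, ← hab, he.inner_eq_zero hj.symm]
    have h1 := inner_nonneg_of_isIdempotent ha (he.isIdempotent j)
    have h2 := inner_nonneg_of_isIdempotent hb (he.isIdempotent j)
    exact ⟨mul_eq_zero_of_isIdempotent ha (he.isIdempotent j) (by linarith),
      mul_eq_zero_of_isIdempotent hb (he.isIdempotent j) (by linarith)⟩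
  let f : Fin (rank V) → V := fun j => if j = i then a else e j
  have hfi : f i = a := if_pos rfl
  have hfj : ∀ j, j ≠ i → f j = e j := fun j hj => if_neg hj
  have hbf : ∀ j, b * f j = 0 := by
    intro j
    by_cases hj : j = i
    · rw [hj, hfi, mul_comm, hab0]
    · rw [hfj j hj, (horth j hj).2]
  -- Replacing `e i` by `a` and `b` gives a complete system with `rank V + 1` members, contradicting
  -- `card_le_rank`.
  let g : Option (Fin (rank V)) → V := fun o => o.elim b f
  have hg : IsOrthogonalSystem g := by
    refine ⟨?_, ?_, ?_, ?_⟩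
    · rintro (_ | j)
      · exact hb
      · by_cases hj : j = i
        · change IsIdempotent (f j); rw [hj, hfi]; exact ha
        · change IsIdempotent (f j); rw [hfj j hj]; exact he.isIdempotent j
    · rintro (_ | j)
      · exact hb0
      · by_cases hj : j = i
        · change f j ≠ 0; rw [hj, hfi]; exact ha0
        · change f j ≠ 0; rw [hfj j hj]; exact he.ne_zero j
    · rintro (_ | j) (_ | k) hjk
      · exact absurd rfl hjk
      · exact hbf k
      · change f j * b = 0; rw [mul_comm]; exact hbf j
      · have hjk' : j ≠ k := fun h => hjk (by rw [h])
        change f j * f k = 0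
        by_cases hj : j = i
        · rw [hj, hfi, hfj k (hj ▸ hjk'.symm), (horth k (hj ▸ hjk'.symm)).1]
        · by_cases hk : k = i
          · rw [hk, hfi, hfj j hj, mul_comm, (horth j hj).1]
          · rw [hfj j hj, hfj k hk, he.mul_eq_zero j k hjk']
    · rw [Fintype.sum_option, ← he.sum_eq_one, ← Finset.add_sum_erase _ _ (Finset.mem_univ i),
        ← Finset.add_sum_erase _ e (Finset.mem_univ i), hab]
      have : ∑ x ∈ Finset.univ.erase i, g (some x) = ∑ x ∈ Finset.univ.erase i, e x :=
        Finset.sum_congr rfl fun x hx => hfj x (Finset.ne_of_mem_erase hx)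
      rw [this]
      change b + (f i + _) = _
      rw [hfi]
      abel
  have := hg.card_le_rank
  simp at this

end IsOrthogonalSystem

end OrthogonalSystem

/-! ### The spectral theorem. -/

section Regular

variable {V : Type*} [NormedAddCommGroup V] [InnerProductSpace ℝ V] [EuclideanJordanAlgebra V]
  [FiniteDimensional ℝ V]

attribute [local instance] toNonUnitalNonAssocCommRing isScalarTower smulCommClass

/-- Every element is a combination of orthogonal idempotents, indexed by the coefficients. -/
theorem exists_isOrthogonalSystem (x : V) :
    ∃ (S : Finset ℝ) (c : S → V), IsOrthogonalSystem c ∧ x = ∑ μ : S, (μ : ℝ) • c μ := by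
  classical
  let P := Submodule.span ℝ (Set.range (jpow x))
  have hP : ∀ y ∈ P, mulLeft x y ∈ P := by
    intro y hy
    have h : P ≤ P.comap (mulLeft x) := by
      refine Submodule.span_le.mpr ?_
      rintro _ ⟨k, rfl⟩
      exact Submodule.subset_span ⟨k + 1, rfl⟩
    exact h hy
  have h1P : (1 : V) ∈ P := Submodule.subset_span ⟨0, rfl⟩
  -- This commutation replaces associativity of the subalgebra generated by `x`.
  have hcomm : ∀ y ∈ P, Commute (mulLeft x) (mulLeft y) := by
    intro y hy
    induction hy using Submodule.span_induction with
    | mem _ h => obtain ⟨k, rfl⟩ := h; exact commute_mulLeft_jpow x k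
    | zero =>
      rw [show mulLeft (0 : V) = 0 from map_zero (LinearMap.mul ℝ V)]
      exact Commute.zero_right _
    | add y z _ _ hy hz =>
      rw [show mulLeft (y + z) = mulLeft y + mulLeft z from map_add (LinearMap.mul ℝ V) y z]
      exact hy.add_right hz
    | smul t y _ hy =>
      rw [show mulLeft (t • y) = t • mulLeft y from map_smul (LinearMap.mul ℝ V) t y]
      exact hy.smul_right t
  have hsym := (mulLeft_isSymmetric x).restrict_invariant hP
  let b := hsym.eigenvectorBasis rfl
  let μ := hsym.eigenvalues rfl
  have hb : ∀ i, x * (b i : V) = μ i • (b i : V) := fun i =>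
    congrArg Subtype.val (hsym.apply_eigenvectorBasis rfl i)
  have hone : ∑ i, ⟪(b i : V), 1⟫_ℝ • (b i : V) = 1 := by
    have h := congrArg Subtype.val (b.sum_repr' ⟨1, h1P⟩)
    simpa using h
  -- The component of the unit in the `r`-eigenspace of multiplication by `x` on `P`.
  let c : ℝ → V := fun r => ∑ i with μ i = r, ⟪(b i : V), 1⟫_ℝ • (b i : V)
  have hcP : ∀ r, c r ∈ P := fun r =>
    Submodule.sum_mem _ fun i _ => Submodule.smul_mem _ _ (b i).2
  have hxc : ∀ r, x * c r = r • c r := by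
    intro r
    simp only [c, Finset.mul_sum, Finset.smul_sum]
    refine Finset.sum_congr rfl fun i hi => ?_
    rw [mul_smul_comm, hb, (Finset.mem_filter.mp hi).2, smul_comm]
  let I : Finset ℝ := Finset.univ.image μ
  have hsumI : ∑ r ∈ I, c r = 1 := by
    rw [← hone]
    exact Finset.sum_fiberwise_of_maps_to (fun i _ => Finset.mem_image_of_mem μ (Finset.mem_univ i)) _
  have hmul : ∀ r s, r ≠ s → c r * c s = 0 := by
    intro r s hrs
    -- Multiplication by `x` commutes with multiplication by `c r`. By symmetry the product is an
    -- eigenvector for both `r` and `s`, hence zero.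
    have key : ∀ r s, x * (c r * c s) = s • (c r * c s) := by
      intro r s
      have h := LinearMap.congr_fun (hcomm (c r) (hcP r)) (c s)
      simp only [Module.End.mul_apply, mulLeft_apply] at h
      rw [h, hxc, mul_smul_comm]
    have h1 := key r s
    have h2 := key s r
    rw [mul_comm (c s)] at h2
    have h3 : (s - r) • (c r * c s) = 0 := by rw [sub_smul, ← h1, ← h2, sub_self]
    exact (smul_eq_zero.mp h3).resolve_left (sub_ne_zero.mpr hrs.symm)
  let S := I.filter fun r => c r ≠ 0
  have hsumS : ∑ r ∈ S, c r = 1 := by rw [Finset.sum_filter_ne_zero, hsumI]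
  have hidem : ∀ r ∈ S, c r * c r = c r := by
    intro r hr
    have h : c r * ∑ s ∈ S, c s = c r := by rw [hsumS, mul_one']
    rw [Finset.mul_sum, Finset.sum_eq_single_of_mem r hr fun s _ hs => hmul r s hs.symm] at h
    exact h
  refine ⟨S, fun r => c r, ⟨fun r => hidem r r.2, fun r => (Finset.mem_filter.mp r.2).2,
    fun r s hrs => hmul r s fun h => hrs (Subtype.ext h), ?_⟩, ?_⟩
  · rw [← hsumS]; exact Finset.sum_coe_sort S c
  · have h : x * ∑ r ∈ S, c r = x := by rw [hsumS, mul_one']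
    rw [Finset.mul_sum] at h
    simp only [hxc] at h
    rw [← h]
    exact (Finset.sum_coe_sort S fun r => r • c r).symm

/-- An element whose powers span a space of maximal dimension is a combination of a complete
orthogonal system of maximal size. -/
theorem exists_isOrthogonalSystem_of_finrank_eq {x : V}
    (hx : rank V ≤ Module.finrank ℝ (Submodule.span ℝ (Set.range (jpow x)))) :
    ∃ (v : Fin (rank V) → ℝ) (c : Fin (rank V) → V),
      IsOrthogonalSystem c ∧ x = ∑ i, v i • c i := by
  obtain ⟨S, c, hc, hxc⟩ := exists_isOrthogonalSystem x
  have hle : rank V ≤ Fintype.card S := by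
    refine hx.trans ?_
    rw [← finrank_span_eq_card hc.linearIndependent]
    refine Submodule.finrank_mono (Submodule.span_le.mpr ?_)
    rintro _ ⟨k, rfl⟩
    rw [hxc, hc.jpow_sum_smul]
    exact Submodule.sum_mem _ fun i _ =>
      Submodule.smul_mem _ _ (Submodule.subset_span (Set.mem_range_self i))
  let σ : Fin (rank V) ≃ S := (Fintype.equivFinOfCardEq (le_antisymm hc.card_le_rank hle)).symm
  refine ⟨fun i => (σ i : ℝ), fun i => c (σ i), ⟨fun i => hc.isIdempotent _, fun i => hc.ne_zero _,
    fun i j hij => hc.mul_eq_zero _ _ (σ.injective.ne hij), ?_⟩, ?_⟩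
  · rw [← hc.sum_eq_one]; exact σ.sum_comp c
  · conv_lhs => rw [hxc]
    exact (σ.sum_comp fun s => (s : ℝ) • c s).symm

variable (V) in
theorem exists_finrank_span_jpow_eq_rank :
    ∃ x : V, Module.finrank ℝ (Submodule.span ℝ (Set.range (jpow x))) = rank V :=
  Nat.sSup_mem (Set.range_nonempty _) (IsOrthogonalSystem.bddAbove_finrank_span_jpow V)

/-- The product as a continuous bilinear map. -/
noncomputable def mulL : V →L[ℝ] V →L[ℝ] V := (LinearMap.mul ℝ V).toContinuousBilinearMap

@[simp] theorem mulL_apply (x y : V) : mulL x y = x * y := rfl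

theorem analyticAt_jpow_line (y w : V) (k : ℕ) (t : ℝ) :
    AnalyticAt ℝ (fun s : ℝ => jpow (y + s • w) k) t := by
  induction k with
  | zero => exact analyticAt_const
  | succ k ih =>
    have h1 : AnalyticAt ℝ (fun s : ℝ => y + s • w) t :=
      analyticAt_const.add (analyticAt_id.smul analyticAt_const)
    exact ((mulL (V := V)).analyticAt_bilinear _).comp (h1.prod ih)

open Filter Topology in
/-- The elements whose powers span a space of maximal dimension are dense. -/
theorem mem_closure_finrank_span_jpow (y : V) :
    y ∈ closure {x : V | rank V ≤ Module.finrank ℝ (Submodule.span ℝ (Set.range (jpow x)))} := by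
  obtain ⟨x₀, hx₀⟩ := exists_finrank_span_jpow_eq_rank V
  obtain ⟨B, hBsub, hBspan, hBli⟩ := exists_linearIndependent ℝ (Set.range (jpow x₀))
  have : Fintype B := (LinearIndependent.setFinite hBli).fintype
  choose g hg using fun b : B => hBsub b.2
  have hcard : Fintype.card B = rank V := by
    rw [← hx₀, ← hBspan]
    exact (finrank_span_set_eq_card hBli).symm ▸ (by simp)
  obtain ⟨φ, hφ⟩ : ∃ φ : V →ₗ[ℝ] (B →₀ ℝ), ∀ b : B, φ b = Finsupp.single b 1 := by
    obtain ⟨φ, hφ⟩ := LinearMap.exists_extend hBli.repr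
    refine ⟨φ, fun b => ?_⟩
    have hb : (b : V) ∈ Submodule.span ℝ (Set.range ((↑) : B → V)) :=
      Submodule.subset_span ⟨b, rfl⟩
    have h := LinearMap.congr_fun hφ ⟨b, hb⟩
    rw [LinearMap.comp_apply] at h
    exact h.trans (hBli.repr_eq_single b ⟨b, hb⟩ rfl)
  classical
  let z : ℝ → V := fun s => y + s • (x₀ - y)
  -- The exponents `g b` give a basis of the span of the powers of `x₀`, and `φ` takes coordinates
  -- in it. On the line from `y` (`s = 0`) to `x₀` (`s = 1`) the determinant is analytic and equals
  -- 1 at `s = 1`, so its zeros cannot accumulate at 0.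
  let A : ℝ → Matrix B B ℝ := fun s => Matrix.of fun i j => φ (jpow (z s) (g i)) j
  have hA : ∀ i j, AnalyticOnNhd ℝ (fun s => A s i j) Set.univ := by
    intro i j s _
    let ψ : V →L[ℝ] ℝ := LinearMap.toContinuousLinearMap (Finsupp.lapply j ∘ₗ φ)
    exact (ψ.analyticAt _).comp (analyticAt_jpow_line y (x₀ - y) (g i) s)
  have hdet : AnalyticOnNhd ℝ (fun s => (A s).det) Set.univ := by
    simp only [Matrix.det_apply']
    intro s hs
    refine Finset.analyticAt_fun_sum _ fun σ _ => analyticAt_const.mul ?_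
    exact Finset.analyticAt_fun_prod _ fun i _ => hA _ _ s hs
  have hA1 : A 1 = 1 := by
    ext i j
    have hz1 : z 1 = x₀ := by simp [z]
    simp only [A, Matrix.of_apply, hz1, hg, hφ, Matrix.one_apply, Finsupp.single_apply]
  have hne : ∀ᶠ s in 𝓝[≠] (0 : ℝ), (A s).det ≠ 0 := by
    by_contra hcon
    have hfreq : ∃ᶠ s in 𝓝[≠] (0 : ℝ), (A s).det = 0 := by
      rw [Filter.not_eventually] at hcon
      simpa only [not_not] using hcon
    have h := hdet.eqOn_zero_of_preconnected_of_frequently_eq_zero isPreconnected_univ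
      (Set.mem_univ 0) hfreq (Set.mem_univ 1)
    simp [hA1] at h
  have hlim : Tendsto z (𝓝[≠] 0) (𝓝 y) := by
    have hcont : Continuous z := by fun_prop
    have h := hcont.tendsto 0
    simp only [z, zero_smul, add_zero] at h
    exact h.mono_left nhdsWithin_le_nhds
  refine mem_closure_of_tendsto hlim (hne.mono fun s hs => ?_)
  have hrow : LinearIndependent ℝ (A s).row :=
    Matrix.linearIndependent_rows_iff_isUnit.mpr
      ((Matrix.isUnit_iff_isUnit_det _).mpr (isUnit_iff_ne_zero.mpr hs))
  have hli : LinearIndependent ℝ fun i : B => jpow (z s) (g i) :=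
    LinearIndependent.of_comp ((Finsupp.linearEquivFunOnFinite ℝ ℝ B).toLinearMap ∘ₗ φ) hrow
  change rank V ≤ _
  rw [← hcard, ← finrank_span_eq_card hli]
  refine Submodule.finrank_mono (Submodule.span_mono ?_)
  rintro _ ⟨i, rfl⟩
  exact ⟨g i, rfl⟩

theorem continuous_mul_of_continuous {X : Type*} [TopologicalSpace X] {f g : X → V}
    (hf : Continuous f) (hg : Continuous g) : Continuous fun a => f a * g a :=
  (mulL (V := V)).continuous₂.comp (hf.prodMk hg)

/-- From `‖c‖ = ‖c * c‖ ≤ ‖mulL‖ ‖c‖²`. It turns the open condition `c ≠ 0` into a closed one, so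
that limits of systems do not degenerate. -/
theorem IsIdempotent.one_le_mul_norm {c : V} (hc : IsIdempotent c) (h0 : c ≠ 0) :
    1 ≤ ‖(mulL : V →L[ℝ] V →L[ℝ] V)‖ * ‖c‖ := by
  have h := (mulL (V := V)).le_opNorm₂ c c
  rw [mulL_apply, show c * c = c from hc] at h
  have hpos := norm_pos_iff.mpr h0
  by_contra! hlt
  nlinarith

/-- **Spectral theorem.** Every element is a combination of a complete orthogonal system of maximal
size: this holds for a dense set of elements, and such systems form a compact set. -/
theorem exists_isOrthogonalSystem_rank (x : V) :
    ∃ (v : Fin (rank V) → ℝ) (c : Fin (rank V) → V),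
      IsOrthogonalSystem c ∧ x = ∑ i, v i • c i := by
  let K : Set (Fin (rank V) → V) := {c | IsOrthogonalSystem c}
  have hK : K = (⋂ i, {c | c i * c i = c i}) ∩
      (⋂ i, {c | 1 ≤ ‖(mulL : V →L[ℝ] V →L[ℝ] V)‖ * ‖c i‖}) ∩
      (⋂ i, ⋂ j, ⋂ _ : i ≠ j, {c | c i * c j = 0}) ∩ {c | ∑ i, c i = 1} := by
    ext c
    simp only [Set.mem_inter_iff, Set.mem_iInter, Set.mem_ofPred_eq, K]
    constructor
    · intro hc
      exact ⟨⟨⟨hc.isIdempotent, fun i => (hc.isIdempotent i).one_le_mul_norm (hc.ne_zero i)⟩,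
        hc.mul_eq_zero⟩, hc.sum_eq_one⟩
    · rintro ⟨⟨⟨h1, h2⟩, h3⟩, h4⟩
      refine ⟨h1, fun i hi => ?_, h3, h4⟩
      have h := h2 i
      rw [hi, norm_zero, mul_zero] at h
      linarith
  have hclosed : IsClosed K := by
    rw [hK]
    refine ((IsClosed.inter ?_ ?_).inter ?_).inter ?_
    · exact isClosed_iInter fun i => isClosed_eq
        (continuous_mul_of_continuous (continuous_apply i) (continuous_apply i)) (continuous_apply i)
    · exact isClosed_iInter fun i => isClosed_le continuous_const
        (continuous_const.mul (continuous_apply i).norm)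
    · exact isClosed_iInter fun i => isClosed_iInter fun j => isClosed_iInter fun _ => isClosed_eq
        (continuous_mul_of_continuous (continuous_apply i) (continuous_apply j)) continuous_const
    · exact isClosed_eq (continuous_finsetSum _ fun i _ => continuous_apply i) continuous_const
  have hcompact : IsCompact K := by
    refine Metric.isCompact_of_isClosed_isBounded hclosed ?_
    refine (Metric.isBounded_closedBall (x := (0 : Fin (rank V) → V)) (r := ‖(1 : V)‖)).subset ?_
    intro c hc
    rw [mem_closedBall_zero_iff]
    exact (pi_norm_le_iff_of_nonneg (norm_nonneg _)).mpr fun i => (hc.isIdempotent i).norm_le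
  have : CompactSpace K := isCompact_iff_compactSpace.mp hcompact
  -- The coefficients are continuous functions of the element and the system, so they need no
  -- compactness of their own: projecting along the compact factor `K` keeps `G` closed.
  let G : Set (V × K) := {p | p.1 = ∑ i, (⟪p.1, p.2.1 i⟫_ℝ / ⟪p.2.1 i, p.2.1 i⟫_ℝ) • p.2.1 i}
  have hcoord : ∀ i, Continuous fun p : V × K => p.2.1 i := fun i =>
    (continuous_apply i).comp (continuous_subtype_val.comp continuous_snd)
  have hG : IsClosed G := by
    refine isClosed_eq continuous_fst (continuous_finsetSum _ fun i _ => ?_)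
    refine Continuous.smul (Continuous.div ?_ ?_ ?_) (hcoord i)
    · exact continuous_fst.inner (hcoord i)
    · exact (hcoord i).inner (hcoord i)
    · exact fun p => IsOrthogonalSystem.inner_self_ne_zero p.2.2 i
  have himage : IsClosed (Prod.fst '' G) := isClosedMap_fst_of_compactSpace G hG
  have hsub : {x : V | rank V ≤ Module.finrank ℝ (Submodule.span ℝ (Set.range (jpow x)))} ⊆
      Prod.fst '' G := by
    intro y hy
    obtain ⟨v, c, hc, hyc⟩ := exists_isOrthogonalSystem_of_finrank_eq hy
    refine ⟨(y, ⟨c, hc⟩), ?_, rfl⟩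
    change y = ∑ i, (⟪y, c i⟫_ℝ / ⟪c i, c i⟫_ℝ) • c i
    conv_lhs => rw [hyc]
    refine Finset.sum_congr rfl fun i _ => ?_
    rw [hyc, hc.inner_sum_smul, mul_div_cancel_right₀ _ (hc.inner_self_ne_zero i)]
  obtain ⟨⟨y, c, hc⟩, hy, rfl⟩ :=
    closure_minimal hsub himage (mem_closure_finrank_span_jpow x)
  exact ⟨_, c, hc, hy⟩

theorem exists_isEigenvalueVector (x : V) : ∃ v, IsEigenvalueVector x v := by
  obtain ⟨v, c, hc, hx⟩ := exists_isOrthogonalSystem_rank x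
  let σ := Tuple.sort fun i => -v i
  have hσ : Monotone ((fun i => -v i) ∘ σ) := Tuple.monotone_sort _
  refine ⟨fun i => v (σ i), fun i j hij => neg_le_neg_iff.mp (hσ hij), fun i => c (σ i), ?_, ?_⟩
  · refine IsOrthogonalSystem.isJordanFrame ⟨fun i => hc.isIdempotent _, fun i => hc.ne_zero _,
      fun i j hij => hc.mul_eq_zero _ _ (σ.injective.ne hij), ?_⟩
    rw [← hc.sum_eq_one]; exact Equiv.sum_comp σ c
  · rw [hx]; exact (Equiv.sum_comp σ fun i => v i • c i).symm

theorem isEigenvalueVector_eigenvalues (x : V) : IsEigenvalueVector x (eigenvalues x) := by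
  rw [eigenvalues, dif_pos (exists_isEigenvalueVector x)]
  exact (exists_isEigenvalueVector x).choose_spec

end Regular

/-! ### Majorization in `ℝⁿ`. -/

section Majorization

variable {n : ℕ}

theorem antitone_decr (p : Fin n → ℝ) : Antitone (decr p) := fun _ _ hij =>
  neg_le_neg_iff.mp (Tuple.monotone_sort (fun j => -p j) hij)

theorem sum_decr (p : Fin n → ℝ) : ∑ i, decr p i = ∑ i, p i :=
  Equiv.sum_comp (Tuple.sort fun j => -p j) p

theorem exists_decr_eq (p : Fin n → ℝ) (i : Fin n) : ∃ j, decr p j = p i :=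
  ⟨(Tuple.sort fun j => -p j).symm i, by simp [decr]⟩

theorem card_filter_val_lt {k : ℕ} (hk : k ≤ n) :
    (Finset.univ.filter fun i : Fin n => i.val < k).card = k := by
  rw [Fin.card_filter_val_lt, min_eq_right hk]

/-- The sum of the `k` largest components dominates every weighted sum with weights in `[0, 1]` of
total mass `k`. -/
theorem sum_mul_le_sumLargest {k : ℕ} (hk1 : 1 ≤ k) (hkn : k ≤ n) (p a : Fin n → ℝ)
    (ha0 : ∀ i, 0 ≤ a i) (ha1 : ∀ i, a i ≤ 1) (ha : ∑ i, a i = k) :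
    ∑ i, a i * p i ≤ sumLargest k p := by
  let σ := Tuple.sort fun j => -p j
  have hσ : ∑ i, a i * p i = ∑ i, a (σ i) * decr p i :=
    (Equiv.sum_comp σ fun i => a i * p i).symm
  have hσ1 : ∑ i, a (σ i) = k := by rw [Equiv.sum_comp σ a, ha]
  -- The `k`-th largest component. Since the weights have total mass `k`, subtracting `θ` from every
  -- component changes both sides by `kθ`, and the comparison becomes termwise.
  let θ := decr p ⟨k - 1, by omega⟩
  have key : ∀ i : Fin n, a (σ i) * (decr p i - θ) ≤ if i.val < k then decr p i - θ else 0 := by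
    intro i
    split_ifs with hi
    · have h : θ ≤ decr p i := antitone_decr p (by rw [Fin.le_def]; change i.val ≤ k - 1; omega)
      exact mul_le_of_le_one_left (sub_nonneg.mpr h) (ha1 _)
    · have h : decr p i ≤ θ := antitone_decr p (by rw [Fin.le_def]; change k - 1 ≤ i.val; omega)
      exact mul_nonpos_of_nonneg_of_nonpos (ha0 _) (sub_nonpos.mpr h)
  have h := Finset.sum_le_sum fun i (_ : i ∈ Finset.univ) => key i
  rw [← Finset.sum_filter, Finset.sum_sub_distrib, Finset.sum_const, card_filter_val_lt hkn] at h
  simp only [mul_sub, Finset.sum_sub_distrib, ← Finset.sum_mul, hσ1, nsmul_eq_mul] at h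
  rw [hσ, sumLargest]
  linarith

/-- A doubly stochastic matrix maps every vector to a vector majorized by it. -/
theorem majorized_of_doublyStochastic {A : Fin n → Fin n → ℝ} {p q : Fin n → ℝ}
    (hA : ∀ i j, 0 ≤ A i j) (hrow : ∀ i, ∑ j, A i j = 1) (hcol : ∀ j, ∑ i, A i j = 1)
    (hp : ∀ i, p i = ∑ j, A i j * q j) : Majorized p q := by
  refine ⟨fun k hk1 hkn => ?_, ?_⟩
  · let σ := Tuple.sort fun j => -p j
    -- The weights are partial column sums of `A`: they lie in `[0, 1]`, and the row sums give them
    -- total mass `k`.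
    have h : sumLargest k p = ∑ j, (∑ i with i.val < k, A (σ i) j) * q j := by
      have hd : ∀ i, decr p i = ∑ j, A (σ i) j * q j := fun i => hp (σ i)
      simp only [sumLargest, hd, Finset.sum_mul]
      exact Finset.sum_comm
    rw [h]
    refine sum_mul_le_sumLargest hk1 hkn q _ (fun j => Finset.sum_nonneg fun i _ => hA (σ i) j) ?_ ?_
    · intro j
      rw [← hcol j, ← Equiv.sum_comp σ fun i => A i j]
      exact Finset.sum_le_sum_of_subset_of_nonneg (Finset.filter_subset _ _) fun i _ _ => hA (σ i) j
    · rw [Finset.sum_comm]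
      simp only [hrow, Finset.sum_const, card_filter_val_lt hkn, nsmul_eq_mul, mul_one]
  · rw [sum_decr, sum_decr]
    simp only [hp]
    rw [Finset.sum_comm]
    simp only [← Finset.sum_mul, hcol, one_mul]

theorem Majorized.sum_eq {p q : Fin n → ℝ} (h : Majorized p q) : ∑ i, p i = ∑ i, q i := by
  rw [← sum_decr p, h.2, sum_decr]

theorem sumLargest_one (p : Fin n → ℝ) (hn : 0 < n) : sumLargest 1 p = decr p ⟨0, hn⟩ := by
  have h : (Finset.univ.filter fun i : Fin n => i.val < 1) = {⟨0, hn⟩} := by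
    ext i
    simp [Fin.ext_iff]
  rw [sumLargest, h, Finset.sum_singleton]

theorem sumLargest_pred_add (p : Fin n → ℝ) (hn : 0 < n) :
    sumLargest (n - 1) p + decr p ⟨n - 1, by omega⟩ = ∑ i, p i := by
  have h : (Finset.univ.filter fun i : Fin n => i.val < n - 1) =
      Finset.univ.erase ⟨n - 1, by omega⟩ := by
    ext i
    simp only [Finset.mem_filter, Finset.mem_univ, true_and, Finset.mem_erase, ne_eq, Fin.ext_iff,
      and_true]
    omega
  rw [sumLargest, h, Finset.sum_erase_add _ _ (Finset.mem_univ _), sum_decr]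

theorem Majorized.le_of_forall_le {p q : Fin n → ℝ} (h : Majorized p q) {C : ℝ}
    (hC : ∀ j, q j ≤ C) (i : Fin n) : p i ≤ C := by
  have hn : 0 < n := i.pos
  obtain ⟨j, hj⟩ := exists_decr_eq p i
  have h1 := h.1 1 le_rfl hn
  rw [sumLargest_one p hn, sumLargest_one q hn] at h1
  calc p i = decr p j := hj.symm
    _ ≤ decr p ⟨0, hn⟩ := antitone_decr p (Fin.le_def.mpr (Nat.zero_le _))
    _ ≤ decr q ⟨0, hn⟩ := h1
    _ ≤ C := hC _

/-- The least component is the total minus the `n - 1` largest; equal totals reverse the inequality.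
-/
theorem Majorized.le_of_forall_ge {p q : Fin n → ℝ} (h : Majorized p q) {C : ℝ}
    (hC : ∀ j, C ≤ q j) (i : Fin n) : C ≤ p i := by
  have hn : 0 < n := i.pos
  obtain ⟨j, hj⟩ := exists_decr_eq p i
  have h1 : sumLargest (n - 1) p ≤ sumLargest (n - 1) q := by
    -- Majorization says nothing about `k = 0`, which occurs here when `n = 1`.
    rcases Nat.eq_zero_or_pos (n - 1) with h0 | h0
    · simp [h0, sumLargest]
    · exact h.1 _ h0 (Nat.sub_le _ _)
  have h2 := sumLargest_pred_add p hn
  have h3 := sumLargest_pred_add q hn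
  have h4 := h.sum_eq
  calc C ≤ decr q ⟨n - 1, by omega⟩ := hC _
    _ ≤ decr p ⟨n - 1, by omega⟩ := by linarith
    _ ≤ decr p j := antitone_decr p (by rw [Fin.le_def]; change j.val ≤ n - 1; omega)
    _ = p i := hj

end Majorization

/-! ### Eigenvalues under the trace inner product, and the two implications. -/

section TraceInnerProduct

variable {V : Type*} [NormedAddCommGroup V] [InnerProductSpace ℝ V] [EuclideanJordanAlgebra V]

attribute [local instance] toNonUnitalNonAssocCommRing isScalarTower smulCommClass

/-- A primitive idempotent has exactly one nonzero coordinate, equal to `1`, in any Jordan frame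
in which it is diagonal. -/
theorem IsPrimitive.exists_coord_eq_single {c : V} (hc : IsPrimitive c)
    {ι : Type*} [Fintype ι] [DecidableEq ι] {e : ι → V} (he : IsOrthogonalSystem e)
    {v : ι → ℝ} (hv : c = ∑ i, v i • e i) : ∃ i, v = Pi.single i 1 := by
  have h01 : ∀ i, v i = 0 ∨ v i = 1 := by
    have hcc : ∑ i, (v i * v i) • e i = ∑ i, v i • e i := by
      rw [← he.sum_smul_mul_sum_smul, ← hv]
      exact hc.1
    intro i
    have h := congrArg (fun w => ⟪w, e i⟫_ℝ) hcc
    simp only [he.inner_sum_smul] at h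
    have h2 : v i * (v i - 1) = 0 := by
      have := mul_right_cancel₀ (he.inner_self_ne_zero i) h
      linarith
    rcases mul_eq_zero.mp h2 with h | h
    · exact Or.inl h
    · exact Or.inr (by linarith)
  obtain ⟨i, hi⟩ : ∃ i, v i ≠ 0 := by
    by_contra! h
    exact hc.2.1 (by rw [hv]; simp [h])
  refine ⟨i, ?_⟩
  have hi1 : v i = 1 := (h01 i).resolve_left hi
  -- With coordinates in `{0, 1}` the remainder is itself idempotent, so primitivity forces it to
  -- vanish.
  have hsplit : c = e i + ∑ j ∈ Finset.univ.erase i, v j • e j := by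
    rw [hv, ← Finset.add_sum_erase _ _ (Finset.mem_univ i), hi1, one_smul]
  have hrest : ∑ j ∈ Finset.univ.erase i, v j • e j = ∑ j, Function.update v i 0 j • e j := by
    rw [← Finset.add_sum_erase _ _ (Finset.mem_univ i), Function.update_self, zero_smul, zero_add]
    refine Finset.sum_congr rfl fun j hj => ?_
    rw [Function.update_of_ne (Finset.ne_of_mem_erase hj)]
  have hidem : IsIdempotent (∑ j, Function.update v i 0 j • e j) := by
    change _ * _ = _
    rw [he.sum_smul_mul_sum_smul]
    refine Finset.sum_congr rfl fun j _ => ?_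
    by_cases hj : j = i
    · simp [hj]
    · rw [Function.update_of_ne hj]
      rcases h01 j with h | h <;> simp [h]
  have hzero : ∑ j, Function.update v i 0 j • e j = 0 := by
    by_contra h0
    exact hc.2.2 _ _ (he.isIdempotent i) hidem (he.ne_zero i) h0 (hrest ▸ hsplit)
  ext j
  by_cases hj : j = i
  · rw [hj, hi1, Pi.single_eq_same]
  · have h := congrArg (fun w => ⟪w, e j⟫_ℝ) hzero
    simp only [he.inner_sum_smul, inner_zero_left, Function.update_of_ne hj] at h
    rw [Pi.single_eq_of_ne hj]
    exact (mul_eq_zero.mp h).resolve_right (he.inner_self_ne_zero j)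

theorem trace_eq_inner_one (htrace : ∀ x y : V, ⟪x, y⟫_ℝ = trace (x * y)) (x : V) :
    trace x = ⟪x, 1⟫_ℝ := by
  rw [htrace, mul_one']

variable [FiniteDimensional ℝ V]

theorem IsPrimitive.trace_eq_one {c : V} (hc : IsPrimitive c) : trace c = 1 := by
  obtain ⟨_, e, he, hv⟩ := isEigenvalueVector_eigenvalues c
  obtain ⟨i, hi⟩ := hc.exists_coord_eq_single he.isOrthogonalSystem hv
  rw [trace, hi, Finset.sum_pi_single']
  simp

theorem IsPrimitive.inner_self (htrace : ∀ x y : V, ⟪x, y⟫_ℝ = trace (x * y)) {c : V}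
    (hc : IsPrimitive c) : ⟪c, c⟫_ℝ = 1 := by
  rw [htrace, show c * c = c from hc.1, hc.trace_eq_one]

theorem IsPrimitive.inner_one (htrace : ∀ x y : V, ⟪x, y⟫_ℝ = trace (x * y)) {c : V}
    (hc : IsPrimitive c) : ⟪c, 1⟫_ℝ = 1 := by
  rw [inner_one_of_isIdempotent hc.1, hc.inner_self htrace]

/-- The eigenvalues of a primitive idempotent are `1, 0, …, 0`. -/
theorem IsPrimitive.eigenvalues_apply_zero {c : V} (hc : IsPrimitive c) (hn : 0 < rank V) :
    eigenvalues c = Pi.single ⟨0, hn⟩ 1 := by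
  obtain ⟨hanti, e, he, hv⟩ := isEigenvalueVector_eigenvalues c
  obtain ⟨i, hi⟩ := hc.exists_coord_eq_single he.isOrthogonalSystem hv
  have h := hanti (show (⟨0, hn⟩ : Fin (rank V)) ≤ i from Fin.le_def.mpr (Nat.zero_le _))
  rw [hi] at h ⊢
  by_cases h0 : i = ⟨0, hn⟩
  · rw [h0]
  · rw [Pi.single_eq_same, Pi.single_eq_of_ne (Ne.symm h0)] at h
    linarith

/-- The eigenvalues of the opposite of a primitive idempotent are `0, …, 0, -1`. -/
theorem IsPrimitive.eigenvalues_neg {c : V} (hc : IsPrimitive c) (hn : 0 < rank V) :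
    eigenvalues (-c) = -Pi.single ⟨rank V - 1, by omega⟩ 1 := by
  obtain ⟨hanti, e, he, hv⟩ := isEigenvalueVector_eigenvalues (-c)
  have hv' : c = ∑ i, (-eigenvalues (-c)) i • e i := by
    simp only [Pi.neg_apply, neg_smul, Finset.sum_neg_distrib, ← hv, neg_neg]
  obtain ⟨i, hi⟩ := hc.exists_coord_eq_single he.isOrthogonalSystem hv'
  have hi' : eigenvalues (-c) = -Pi.single i 1 := by rw [← hi, neg_neg]
  have h := hanti (show i ≤ (⟨rank V - 1, by omega⟩ : Fin (rank V)) from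
    Fin.le_def.mpr (by change i.val ≤ rank V - 1; omega))
  rw [hi'] at h ⊢
  by_cases h0 : i = ⟨rank V - 1, by omega⟩
  · rw [h0]
  · rw [Pi.neg_apply, Pi.neg_apply, Pi.single_eq_same, Pi.single_eq_of_ne (Ne.symm h0)] at h
    linarith

theorem eigenvalues_one (i : Fin (rank V)) : eigenvalues (1 : V) i = 1 := by
  obtain ⟨_, e, he, hv⟩ := isEigenvalueVector_eigenvalues (1 : V)
  have h := he.isOrthogonalSystem.inner_sum_smul (eigenvalues 1) i
  rw [← hv, real_inner_comm, inner_one_of_isIdempotent (he.1 i).1] at h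
  exact (mul_eq_right₀ (he.isOrthogonalSystem.inner_self_ne_zero i)).mp h.symm

theorem eigenvalues_eq_inner (htrace : ∀ x y : V, ⟪x, y⟫_ℝ = trace (x * y)) {x : V}
    {v : Fin (rank V) → ℝ} {e : Fin (rank V) → V} (he : IsJordanFrame e) (hv : x = ∑ i, v i • e i)
    (i : Fin (rank V)) : v i = ⟪x, e i⟫_ℝ := by
  rw [hv, he.isOrthogonalSystem.inner_sum_smul, (he.1 i).inner_self htrace, mul_one]

/-- Eigenvalues are inner products with frame members, and idempotents have nonnegative inner
products with each other. The criterion is linear in `x` and involves no chosen frame. -/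
theorem mem_symmetricCone_iff (htrace : ∀ x y : V, ⟪x, y⟫_ℝ = trace (x * y)) {x : V} :
    x ∈ symmetricCone V ↔ ∀ c : V, IsIdempotent c → 0 ≤ ⟪x, c⟫_ℝ := by
  obtain ⟨_, e, he, hv⟩ := isEigenvalueVector_eigenvalues x
  constructor
  · intro hx c hc
    rw [hv, sum_inner]
    refine Finset.sum_nonneg fun i _ => ?_
    rw [inner_smul_left]
    exact mul_nonneg (hx i) (inner_nonneg_of_isIdempotent (he.1 i).1 hc)
  · intro hx i
    rw [eigenvalues_eq_inner htrace he hv i]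
    exact hx _ (he.1 i).1

theorem mem_symmetricCone_of_isIdempotent (htrace : ∀ x y : V, ⟪x, y⟫_ℝ = trace (x * y)) {c : V}
    (hc : IsIdempotent c) : c ∈ symmetricCone V :=
  (mem_symmetricCone_iff htrace).mpr fun _ hd => inner_nonneg_of_isIdempotent hc hd

/-- A combination of idempotents with nonnegative coefficients belongs to the symmetric cone. -/
theorem sum_smul_mem_symmetricCone (htrace : ∀ x y : V, ⟪x, y⟫_ℝ = trace (x * y))
    {ι : Type*} [Fintype ι] {v : ι → ℝ} {e : ι → V} (he : ∀ i, IsIdempotent (e i))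
    (hv : ∀ i, 0 ≤ v i) : ∑ i, v i • e i ∈ symmetricCone V := by
  refine (mem_symmetricCone_iff htrace).mpr fun c hc => ?_
  rw [sum_inner]
  refine Finset.sum_nonneg fun i _ => ?_
  rw [inner_smul_left]
  exact mul_nonneg (hv i) (inner_nonneg_of_isIdempotent (he i) hc)

/-- A multiple `t • D` of a doubly stochastic map satisfies `λ((t • D) x) ≺ t λ(x)`. -/
theorem IsDoublyStochastic.majorized_smul (htrace : ∀ x y : V, ⟪x, y⟫_ℝ = trace (x * y))
    {D : V →ₗ[ℝ] V} (hD : IsDoublyStochastic D) (t : ℝ) (x : V) :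
    Majorized (eigenvalues ((t • D) x)) ((fun _ => t) * eigenvalues x) := by
  obtain ⟨_, e, he, hv⟩ := isEigenvalueVector_eigenvalues x
  obtain ⟨_, f, hf, hw⟩ := isEigenvalueVector_eigenvalues ((t • D) x)
  -- Entries are nonnegative by cone preservation, rows sum to 1 by `D 1 = 1`, and columns by the
  -- adjoint condition.
  refine majorized_of_doublyStochastic (A := fun i j => ⟪D (e j), f i⟫_ℝ) ?_ ?_ ?_ ?_
  · intro i j
    exact (mem_symmetricCone_iff htrace).mp
      (hD.1 _ (mem_symmetricCone_of_isIdempotent htrace (he.1 j).1)) _ (hf.1 i).1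
  · intro i
    rw [← sum_inner, ← map_sum, he.2.2, hD.2.1, real_inner_comm, (hf.1 i).inner_one htrace]
  · intro j
    rw [← inner_sum, hf.2.2, ← LinearMap.adjoint_inner_right, hD.2.2, (he.1 j).inner_one htrace]
  · intro i
    rw [eigenvalues_eq_inner htrace hf hw i, LinearMap.smul_apply]
    conv_lhs => rw [hv]
    rw [map_sum, Finset.smul_sum, sum_inner]
    refine Finset.sum_congr rfl fun j _ => ?_
    rw [map_smul, smul_smul, inner_smul_left, Pi.mul_apply, mul_comm]
    rfl

/-- If `λ(T x) ≺ t λ(x)` for all `x`, then `T` is `t` times a doubly stochastic map. -/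
theorem exists_isDoublyStochastic_of_majorized (htrace : ∀ x y : V, ⟪x, y⟫_ℝ = trace (x * y))
    {T : V →ₗ[ℝ] V} {t : ℝ}
    (hT : ∀ x, Majorized (eigenvalues (T x)) ((fun _ => t) * eigenvalues x)) :
    ∃ D : V →ₗ[ℝ] V, IsDoublyStochastic D ∧ T = t • D := by
  rcases eq_or_ne t 0 with rfl | ht
  · refine ⟨LinearMap.id, ⟨fun x hx => hx, rfl, by rw [LinearMap.adjoint_id]; rfl⟩, ?_⟩
    ext x
    obtain ⟨_, e, he, hv⟩ := isEigenvalueVector_eigenvalues (T x)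
    have h0 : ∀ i, eigenvalues (T x) i = 0 := fun i => le_antisymm
      ((hT x).le_of_forall_le (by simp) i) ((hT x).le_of_forall_ge (by simp) i)
    rw [hv]
    simp [h0]
  have hT1 : T 1 = t • 1 := by
    obtain ⟨_, e, he, hv⟩ := isEigenvalueVector_eigenvalues (T 1)
    have h0 : ∀ i, eigenvalues (T 1) i = t := fun i => le_antisymm
      ((hT 1).le_of_forall_le (fun j => by simp [eigenvalues_one]) i)
      ((hT 1).le_of_forall_ge (fun j => by simp [eigenvalues_one]) i)
    simp only [h0] at hv
    rw [hv, ← Finset.smul_sum, he.2.2]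
  have htr : ∀ x, ⟪T x, 1⟫_ℝ = t * ⟪x, 1⟫_ℝ := by
    intro x
    rw [← trace_eq_inner_one htrace, ← trace_eq_inner_one htrace, trace, trace, (hT x).sum_eq,
      Finset.mul_sum]
    rfl
  refine ⟨t⁻¹ • T, ⟨?_, ?_, ?_⟩, by rw [smul_smul, mul_inv_cancel₀ ht, one_smul]⟩
  · intro x hx
    obtain ⟨_, e, he, hv⟩ := isEigenvalueVector_eigenvalues (T x)
    have h0 : ∀ i, 0 ≤ t⁻¹ * eigenvalues (T x) i := by
      intro i
      -- For negative `t` the upper bound of the majorization is used, for positive `t` the lower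
      -- one.
      rcases lt_or_gt_of_ne ht with hneg | hpos
      · exact mul_nonneg_of_nonpos_of_nonpos (inv_nonpos.mpr hneg.le)
          ((hT x).le_of_forall_le (fun j => mul_nonpos_of_nonpos_of_nonneg hneg.le (hx j)) i)
      · exact mul_nonneg (inv_nonneg.mpr hpos.le)
          ((hT x).le_of_forall_ge (fun j => mul_nonneg hpos.le (hx j)) i)
    have h := sum_smul_mem_symmetricCone htrace (fun i => (he.1 i).1) h0
    have hx' : (t⁻¹ • T) x = ∑ i, (t⁻¹ * eigenvalues (T x) i) • e i := by
      simp only [← smul_smul, ← Finset.smul_sum, ← hv, LinearMap.smul_apply]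
    exact hx' ▸ h
  · rw [LinearMap.smul_apply, hT1, smul_smul, inv_mul_cancel₀ ht, one_smul]
  · refine ext_inner_left ℝ fun x => ?_
    rw [LinearMap.adjoint_inner_right, LinearMap.smul_apply, inner_smul_left, htr,
      RCLike.conj_to_real, ← mul_assoc, inv_mul_cancel₀ ht, one_mul]

/-- If `λ(T x) ≺ q * λ(x)` for all `x` with `q` decreasing, then `q` is constant: compare the traces
of `T c` and `T (-c)` for a primitive idempotent `c`. -/
theorem exists_eq_const_of_majorized (htrace : ∀ x y : V, ⟪x, y⟫_ℝ = trace (x * y))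
    {T : V →ₗ[ℝ] V} {q : Fin (rank V) → ℝ} (hq : Antitone q)
    (hT : ∀ x, Majorized (eigenvalues (T x)) (q * eigenvalues x)) : ∃ t : ℝ, q = fun _ => t := by
  rcases Nat.eq_zero_or_pos (rank V) with hn | hn
  · exact ⟨0, funext fun i => absurd i.isLt (by omega)⟩
  obtain ⟨_, e, he, _⟩ := isEigenvalueVector_eigenvalues (1 : V)
  have hc : IsPrimitive (e ⟨0, hn⟩) := he.1 _
  -- Sorting puts the nonzero eigenvalue of `c` first and that of `-c` last, so the two sums pick
  -- out the first and last components of `q`.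
  have h1 := (hT (e ⟨0, hn⟩)).sum_eq
  have h2 := (hT (-e ⟨0, hn⟩)).sum_eq
  change trace _ = _ at h1 h2
  rw [trace_eq_inner_one htrace, hc.eigenvalues_apply_zero hn] at h1
  rw [trace_eq_inner_one htrace, hc.eigenvalues_neg hn, map_neg, inner_neg_left, h1] at h2
  have hfirst : ∀ k : Fin (rank V), ∑ i, (q * Pi.single k 1 : Fin (rank V) → ℝ) i = q k := by
    intro k
    simp [Pi.single_apply]
  rw [mul_neg] at h2
  simp only [Pi.neg_apply, Finset.sum_neg_distrib, hfirst, neg_inj] at h2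
  refine ⟨q ⟨0, hn⟩, funext fun i => le_antisymm (hq (Fin.le_def.mpr (Nat.zero_le _))) ?_⟩
  rw [h2]
  exact hq (Fin.le_def.mpr (by change i.val ≤ rank V - 1; omega))

end TraceInnerProduct

end EuclideanJordanAlgebra

theorem theorem3p2 {V : Type*} [NormedAddCommGroup V] [InnerProductSpace ℝ V]
    [FiniteDimensional ℝ V] [EuclideanJordanAlgebra V]
    (htrace : ∀ x y : V, ⟪x, y⟫_ℝ = EuclideanJordanAlgebra.trace (x * y))
    (T : V →ₗ[ℝ] V) :
    (∃ q : Fin (EuclideanJordanAlgebra.rank V) → ℝ, Antitone q ∧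
        ∀ x : V, EuclideanJordanAlgebra.Majorized
          (EuclideanJordanAlgebra.eigenvalues (T x))
          (q * EuclideanJordanAlgebra.eigenvalues x)) ↔
      ∃ (t : ℝ) (D : V →ₗ[ℝ] V), EuclideanJordanAlgebra.IsDoublyStochastic D ∧ T = t • D := by
  constructor
  · rintro ⟨q, hq, hT⟩
    obtain ⟨t, rfl⟩ := EuclideanJordanAlgebra.exists_eq_const_of_majorized htrace hq hT
    exact ⟨t, EuclideanJordanAlgebra.exists_isDoublyStochastic_of_majorized htrace hT⟩
  · rintro ⟨t, D, hD, rfl⟩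
    exact ⟨fun _ => t, antitone_const, hD.majorized_smul htrace t⟩
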